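/- Conventions. $\mathsf{Cat}$ is the 2-category of small categories, $\mathsf{CAT}$ that of not necessarily small categories, and $\mathbf 1$ is the terminal category. A prederivator is a strict 2-functor $D\colon \mathsf{Cat}^{\mathrm{op}}\to\mathsf{CAT}$ (where $\mathsf{Cat}^{\mathrm{op}}$ reverses functors but not natural transformations); for $u\colon A\to B$ we write $u^*\colon D(B)\to D(A)$ for the induced restriction functor. It is a derivator if: * (Der1) for each small family $(A_i)$ of small categories, the canonical functor $D(\coprod_i A_i)\to\prod_i D(A_i)$ is an equivalence; * (Der2) a morphism $f$ of $D(A)$ is an isomorphism if and only if $a^*f$ is an isomorphism in $D(\mathbf 1)$ for every object $a\colon\mathbf 1\to A$; * (Der3) every $u^*$ has a left adjoint $u_!$ and a right adjoint $u_*$; * (Der4) for every $u\colon A\to B$ and $b\in B$, with $p\colon(u/b)\to A$ and $q\colon(b/u)\to A$ the projections from the slice categories and $\pi$ the functors from these to $\mathbf 1$, the canonical mates $\pi_!p^*\to b^*u_!$ and $b^*u_*\to\pi_*q^*$ are isomorphisms. For a prederivator $D$ and a small category $A$, $D^A$ denotes the prederivator $C\mapsto D(A\times C)$; a functor $u\colon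 A\to B$ induces $u^*\colon D^B\to D^A$ with components $(u\times \mathrm{id}_C)^*$. "$X\in D^A$" means that $X\in D^A(C)=D(A\times C)$ for some small category $C$, and essential images are taken levelwise in $C$. A functor $u\colon A\to B$ of small categories is a homotopical epimorphism if $u^*\colon D(B)\to D(A)$ is fully faithful for every derivator $D$. Let $[1]=(0<1)$. Given small categories $A_1,A_2$, an integer $n\ge 0$ and objects $s_1,\dots,s_n\in A_1$, $t_1,\dots,t_n\in A_2$, the associated free oriented gluing construction is the pushout $$A=\Bigl(\coprod_{k=1}^n[1]\Bigr)\sqcup_{\coprod_{k=1}^n(\mathbf 1\sqcup\mathbf 1)}(A_1\sqcup A_2)$$ in the category of small categories, formed along $\coprod_k(0,1)\colon\coprod_k(\mathbf 1\sqcup\mathbf 1)\to\coprod_k[1]$ and $s\sqcup t\colon\coprod_k(\mathbf 1\sqcup\mathbf 1)\to A_1\sqcup A_2$; it comes with functors $(i_1,i_2)\colon A_1\sqcup A_2\to A$ and $\beta\colon\coprod_k[1]\to A$. Theorem. Let $A$ be the free oriented gluing construction associated to $(A_1,A_2,s,t)$ and $A'$ that associated to $(A_1',A_2,s',t)$, let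 $u_1\colon A_1\to A_1'$ be a functor with $s'_k=u_1(s_k)$ for all $k$, and let $u\colon A\to A'$ be the functor induced by the universal property of the pushout $A$ from $u_1\sqcup\mathrm{id}_{A_2}$ and $\mathrm{id}_{\coprod_k[1]}$. If $u_1$ is a homotopical epimorphism, then so is $u$. Moreover, for every derivator $D$, an object $X\in D^A$ lies in the essential image of $u^*\colon D^{A'}\to D^A$ if and only if $i_1^*X\in D^{A_1}$ lies in the essential image of $u_1^*\colon D^{A_1'}\to D^{A_1}$. The same equivalence holds for $X\in D(A)$ with respect to $u^*\colon D(A')\to D(A)$ and $u_1^*\colon D(A_1')\to D(A_1)$. -/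

import Mathlib

open CategoryTheory Opposite Bicategory.Opposite

universe u v w

set_option linter.checkUnivs false

noncomputable section

/-! ### Prederivators and derivators -/

/-- A prederivator: a (strict) 2-functor `D : Catᵒᵖ → CAT`. Here `Catᵒᵖ` is obtained from the
2-category of small categories by reversing functors but not natural transformations. -/
abbrev Prederivator : Type (max (u + 1) (v + 1) (w + 1)) :=
  StrictPseudofunctor (Cat.{u, u})ᵒᵖ Cat.{v, w}

namespace Prederivator

variable (D : Prederivator.{u, v, w})

/-- The category `D(A)` of coherent diagrams of shape `A`. -/
abbrev Diag (A : Type u) [SmallCategory A] : Type w :=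
  D.obj (op (Cat.of A))

/-- The restriction functor `u^* : D(B) ⥤ D(A)` of a functor `u : A ⥤ B`. -/
def res {A B : Type u} [SmallCategory A] [SmallCategory B] (F : A ⥤ B) : D.Diag B ⥤ D.Diag A :=
  (D.map F.toCatHom.op).toFunctor

/-- The transformation `α^* : F^* ⟶ G^*` induced by `α : F ⟶ G`. -/
def resMap {A B : Type u} [SmallCategory A] [SmallCategory B] {F G : A ⥤ B} (α : F ⟶ G) :
    D.res F ⟶ D.res G :=
  (D.map₂ (op2 α.toCatHom₂)).toNatTrans

/-- The identification `(F ⋙ G)^* = G^* ⋙ F^*`, which is an equality by strictness of `D`. -/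
def resComp {A B C : Type u} [SmallCategory A] [SmallCategory B] [SmallCategory C]
    (F : A ⥤ B) (G : B ⥤ C) : D.res (F ⋙ G) ≅ D.res G ⋙ D.res F :=
  eqToIso (congrArg Cat.Hom.toFunctor (D.map_comp G.toCatHom.op F.toCatHom.op))

/-- The terminal category, as a small category. -/
abbrev Pt : Type u := Discrete PUnit.{u + 1}

/-- The functor `Pt ⥤ A` classifying an object of `A`. -/
abbrev point {A : Type u} [SmallCategory A] (a : A) : Pt.{u} ⥤ A := Functor.fromPUnit a

/-- The evaluation functor `a^* : D(A) ⥤ D(Pt)`. -/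
abbrev eval {A : Type u} [SmallCategory A] (a : A) : D.Diag A ⥤ D.Diag Pt.{u} := D.res (point a)

/-- The 2-cell `α^* : v^* p^* ⟶ w^* q^*` induced by a 2-cell
`α : p ⋙ v ⟶ q ⋙ w` in a square of small categories. -/
def squareMap {A B C E : Type u} [SmallCategory A] [SmallCategory B] [SmallCategory C]
    [SmallCategory E] {p : E ⥤ A} {v : A ⥤ C} {q : E ⥤ B} {w : B ⥤ C}
    (α : p ⋙ v ⟶ q ⋙ w) : D.res v ⋙ D.res p ⟶ D.res w ⋙ D.res q :=
  (D.resComp p v).inv ≫ D.resMap α ≫ (D.resComp q w).hom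

section Slices

variable {A B : Type u} [SmallCategory A] [SmallCategory B] (F : A ⥤ B) (b : B)

/-- The transformation `p ⋙ F ⟶ π ⋙ b` of the slice square of `(F/b)`. -/
def sliceOver : CostructuredArrow.proj F b ⋙ F ⟶
    Functor.star.{u} (CostructuredArrow F b) ⋙ point b where
  app x := x.hom
  naturality _ _ f := (CostructuredArrow.w f).trans (Category.comp_id _).symm

/-- The transformation `π ⋙ b ⟶ q ⋙ F` of the slice square of `(b/F)`. -/
def sliceUnder : Functor.star.{u} (StructuredArrow b F) ⋙ point b ⟶
    StructuredArrow.proj b F ⋙ F where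
  app x := x.hom
  naturality _ _ f := (Category.id_comp _).trans (StructuredArrow.w f).symm

/-- The canonical mate `π_! p^* ⟶ b^* u_!` of the slice square of `(u/b)`, computed with given
left Kan extension functors. -/
def leftMate {L : D.Diag A ⥤ D.Diag B} (adj : L ⊣ D.res F)
    {colim : D.Diag (CostructuredArrow F b) ⥤ D.Diag Pt.{u}}
    (adjπ : colim ⊣ D.res (Functor.star.{u} (CostructuredArrow F b))) :
    D.res (CostructuredArrow.proj F b) ⋙ colim ⟶ L ⋙ D.eval b :=
  ((mateEquiv adj adjπ).symm (.mk _ _ _ _ (D.squareMap (sliceOver F b)))).natTrans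

/-- The canonical mate `b^* u_* ⟶ π_* q^*` of the slice square of `(b/u)`, computed with given
right Kan extension functors. -/
def rightMate {R : D.Diag A ⥤ D.Diag B} (adj : D.res F ⊣ R)
    {lim : D.Diag (StructuredArrow b F) ⥤ D.Diag Pt.{u}}
    (adjπ : D.res (Functor.star.{u} (StructuredArrow b F)) ⊣ lim) :
    R ⋙ D.eval b ⟶ D.res (StructuredArrow.proj b F) ⋙ lim :=
  (mateEquiv adj adjπ (.mk _ _ _ _ (D.squareMap (sliceUnder F b)))).natTrans

end Slices

/-- The axioms of a derivator. -/
structure IsDerivator : Prop where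
  /-- (Der1): coproducts are sent to products. -/
  der1 : ∀ (I : Type u) (A : I → Type u) [∀ i, SmallCategory (A i)],
    (Functor.pi' fun i => D.res (Sigma.incl (C := A) i)).IsEquivalence
  /-- (Der2): isomorphisms are detected pointwise. -/
  der2 : ∀ (A : Type u) [SmallCategory A] {X Y : D.Diag A} (f : X ⟶ Y),
    IsIso f ↔ ∀ a : A, IsIso ((D.eval a).map f)
  /-- (Der3): left Kan extensions exist. -/
  der3_left : ∀ (A B : Type u) [SmallCategory A] [SmallCategory B] (F : A ⥤ B),
    (D.res F).IsRightAdjoint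
  /-- (Der3): right Kan extensions exist. -/
  der3_right : ∀ (A B : Type u) [SmallCategory A] [SmallCategory B] (F : A ⥤ B),
    (D.res F).IsLeftAdjoint
  /-- (Der4): left Kan extensions are pointwise. -/
  der4_left : ∀ (A B : Type u) [SmallCategory A] [SmallCategory B] (F : A ⥤ B) (b : B)
    (L : D.Diag A ⥤ D.Diag B) (adj : L ⊣ D.res F)
    (colim : D.Diag (CostructuredArrow F b) ⥤ D.Diag Pt.{u})
    (adjπ : colim ⊣ D.res (Functor.star.{u} (CostructuredArrow F b))),
    IsIso (D.leftMate F b adj adjπ)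
  /-- (Der4): right Kan extensions are pointwise. -/
  der4_right : ∀ (A B : Type u) [SmallCategory A] [SmallCategory B] (F : A ⥤ B) (b : B)
    (R : D.Diag A ⥤ D.Diag B) (adj : D.res F ⊣ R)
    (lim : D.Diag (StructuredArrow b F) ⥤ D.Diag Pt.{u})
    (adjπ : D.res (Functor.star.{u} (StructuredArrow b F)) ⊣ lim),
    IsIso (D.rightMate F b adj adjπ)

/-- The 2-functor `B × - : Catᵒᵖ → Catᵒᵖ`. -/
def prodLeft (B : Type u) [SmallCategory B] :
    StrictPseudofunctor (Cat.{u, u})ᵒᵖ (Cat.{u, u})ᵒᵖ where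
  obj A := op (Cat.of (B × A.unop))
  map F := ((𝟭 B).prod F.unop.toFunctor).toCatHom.op
  map₂ η := op2 (NatTrans.prod (𝟙 (𝟭 B)) η.unop2.toNatTrans).toCatHom₂
  map₂_id _ := rfl
  map₂_comp η θ := congrArg (fun x => op2 (NatTrans.toCatHom₂ x))
    (NatTrans.ext (funext fun x => Prod.ext (Category.comp_id (𝟙 x.1)).symm rfl))
  map_id _ := rfl
  map_comp _ _ := rfl
  mapId _ := Iso.refl _
  mapComp _ _ := Iso.refl _
  mapId_eq_eqToIso _ := rfl
  mapComp_eq_eqToIso _ _ := rfl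
  map₂_whisker_left f g g' η := by
    refine congrArg Hom2.op2' (Cat.Hom₂.ext (NatTrans.ext (funext fun x => Prod.ext ?_ ?_)))
    · change 𝟙 x.1 = 𝟙 x.1 ≫ 𝟙 x.1 ≫ 𝟙 x.1
      simp
    · exact ((Category.id_comp _).trans (Category.comp_id _)).symm
  map₂_whisker_right η g := by
    refine congrArg Hom2.op2' (Cat.Hom₂.ext (NatTrans.ext (funext fun x => Prod.ext ?_ ?_)))
    · change 𝟙 x.1 = 𝟙 x.1 ≫ 𝟙 x.1 ≫ 𝟙 x.1
      simp
    · exact ((Category.id_comp _).trans (Category.comp_id _)).symm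
  map₂_associator f g h := by
    refine congrArg Hom2.op2' (Cat.Hom₂.ext (NatTrans.ext (funext fun x => Prod.ext ?_ ?_)))
    · change 𝟙 x.1 = 𝟙 x.1 ≫ 𝟙 x.1 ≫ 𝟙 x.1 ≫ 𝟙 x.1 ≫ 𝟙 x.1
      simp
    · change 𝟙 (f.unop.toFunctor.obj (g.unop.toFunctor.obj (h.unop.toFunctor.obj x.2))) =
        𝟙 _ ≫ 𝟙 _ ≫ 𝟙 _ ≫ f.unop.toFunctor.map (𝟙 _) ≫ 𝟙 _
      simp
  map₂_left_unitor f := by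
    refine congrArg Hom2.op2' (Cat.Hom₂.ext (NatTrans.ext (funext fun x => Prod.ext ?_ ?_)))
    · change 𝟙 x.1 = 𝟙 x.1 ≫ 𝟙 x.1 ≫ 𝟙 x.1
      simp
    · change 𝟙 (f.unop.toFunctor.obj x.2) = 𝟙 _ ≫ 𝟙 _ ≫ 𝟙 _
      simp
  map₂_right_unitor f := by
    refine congrArg Hom2.op2' (Cat.Hom₂.ext (NatTrans.ext (funext fun x => Prod.ext ?_ ?_)))
    · change 𝟙 x.1 = 𝟙 x.1 ≫ 𝟙 x.1 ≫ 𝟙 x.1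
      simp
    · change 𝟙 (f.unop.toFunctor.obj x.2) =
        𝟙 _ ≫ f.unop.toFunctor.map (𝟙 _) ≫ 𝟙 _
      simp

/-- The shifted prederivator `D^B`, given by `A ↦ D(B × A)`. -/
def shift (B : Type u) [SmallCategory B] : Prederivator.{u, v, w} :=
  (prodLeft B).comp D

/-- The component `D^B(C) ⥤ D^A(C)` of the restriction morphism `u^* : D^B → D^A`, that is, the
functor `(u × id_C)^* : D(B × C) ⥤ D(A × C)`. -/
def shiftRes {A B : Type u} [SmallCategory A] [SmallCategory B] (F : A ⥤ B)
    (C : Type u) [SmallCategory C] : (D.shift B).Diag C ⥤ (D.shift A).Diag C :=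
  D.res (A := A × C) (B := B × C) (F.prod (𝟭 C))

end Prederivator

/-- A functor `u : A ⥤ B` between small categories is a homotopical epimorphism if
`u^* : D(B) ⥤ D(A)` is fully faithful for every derivator `D`. -/
def IsHomotopicalEpi {A B : Type u} [SmallCategory A] [SmallCategory B] (F : A ⥤ B) : Prop :=
  ∀ D : Prederivator.{u, v, w}, D.IsDerivator → (D.res F).Full ∧ (D.res F).Faithful

/-! ### Free oriented gluing constructions -/

/-- The poset `[1] = (0 < 1)`, as a small category. -/
abbrev UnitArrow : Type u := AsSmall.{u} (Fin 2)

/-- The functor `(0,1) : 1 ⊔ 1 ⥤ [1]`. -/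
def intervalEnds : Prederivator.Pt.{u} ⊕ Prederivator.Pt.{u} ⥤ UnitArrow.{u} :=
  (Functor.fromPUnit (AsSmall.up.obj (0 : Fin 2))).sum'
    (Functor.fromPUnit (AsSmall.up.obj (1 : Fin 2)))

/-- The functor `∐ₙ (0,1) : ∐ₙ (1 ⊔ 1) ⥤ ∐ₙ [1]`. -/
def gluingEnds (n : ℕ) :
    (Σ _ : Fin n, (Prederivator.Pt.{u} ⊕ Prederivator.Pt.{u})) ⥤ Σ _ : Fin n, UnitArrow.{u} :=
  Sigma.Functor.sigma fun _ => intervalEnds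

section Gluing

variable {A₁ A₂ : Type u} [SmallCategory A₁] [SmallCategory A₂] {n : ℕ}

/-- The functor `s ⊔ t : ∐ₙ (1 ⊔ 1) ⥤ A₁ ⊔ A₂`. -/
def gluingObjects (s : Fin n → A₁) (t : Fin n → A₂) :
    (Σ _ : Fin n, (Prederivator.Pt.{u} ⊕ Prederivator.Pt.{u})) ⥤ A₁ ⊕ A₂ :=
  Sigma.desc fun k => (Prederivator.point (s k)).sum (Prederivator.point (t k))

/-- A free oriented gluing construction associated to `(A₁, A₂, s, t)`: a category `pt` exhibited
as a pushout of `s ⊔ t` along `∐ₙ (0,1)` in the category of small categories. -/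
structure FreeOrientedGluing (s : Fin n → A₁) (t : Fin n → A₂) where
  /-- The category obtained by gluing. -/
  pt : Type u
  [cat : SmallCategory pt]
  /-- The functor `(i₁, i₂) : A₁ ⊔ A₂ ⥤ pt`. -/
  incl : A₁ ⊕ A₂ ⥤ pt
  /-- The functor `β : ∐ₙ [1] ⥤ pt`. -/
  β : (Σ _ : Fin n, UnitArrow.{u}) ⥤ pt
  isPushout : IsPushout (gluingObjects s t).toCatHom (gluingEnds.{u} n).toCatHom
    incl.toCatHom β.toCatHom

namespace FreeOrientedGluing

attribute [instance] FreeOrientedGluing.cat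

variable {s : Fin n → A₁} {t : Fin n → A₂}

/-- The inclusion `i₁ : A₁ ⥤ A` of the first summand. -/
def i₁ (G : FreeOrientedGluing s t) : A₁ ⥤ G.pt := Sum.inl_ A₁ A₂ ⋙ G.incl

variable {A₁' : Type u} [SmallCategory A₁'] {s' : Fin n → A₁'}

theorem gluingObjects_comp_sum (u₁ : A₁ ⥤ A₁') (t : Fin n → A₂)
    (hs : ∀ k, s' k = u₁.obj (s k)) :
    gluingObjects s t ⋙ u₁.sum (𝟭 A₂) = gluingObjects s' t := by
  obtain rfl : s' = fun k => u₁.obj (s k) := funext hs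
  refine CategoryTheory.Functor.ext ?_ ?_
  · rintro ⟨k, x | x⟩ <;> rfl
  · rintro ⟨k, x⟩ ⟨_, y⟩ ⟨f⟩
    induction f using Sum.homInduction with
    | inl x y f =>
      obtain ⟨⟨⟩⟩ := x
      obtain ⟨⟨⟩⟩ := y
      simp [gluingObjects, Sigma.desc, Sigma.descMap]
      exact (Category.comp_id (𝟙 (Sum.inl (u₁.obj (s k)) : A₁' ⊕ A₂))).symm
    | inr x y f =>
      obtain ⟨⟨⟩⟩ := x
      obtain ⟨⟨⟩⟩ := y
      simp [gluingObjects, Sigma.desc, Sigma.descMap]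
      exact (Category.comp_id (𝟙 (Sum.inr (t k) : A₁' ⊕ A₂))).symm

/-- The functor `u : A ⥤ A'` between two compatible gluing constructions which is induced by
`u₁ : A₁ ⥤ A₁'` (with `s' = u₁ ∘ s`) through the universal property of the pushout `A`. -/
def induced (G : FreeOrientedGluing s t) (G' : FreeOrientedGluing s' t) (u₁ : A₁ ⥤ A₁')
    (hs : ∀ k, s' k = u₁.obj (s k)) : G.pt ⥤ G'.pt :=
  (G.isPushout.desc (u₁.sum (𝟭 A₂) ⋙ G'.incl).toCatHom G'.β.toCatHom (by
    refine Eq.trans ?_ G'.isPushout.w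
    exact congrArg (fun F => (F ⋙ G'.incl).toCatHom)
      (gluingObjects_comp_sum u₁ t hs))).toFunctor

end FreeOrientedGluing

end Gluing

end

/-!
Let `M` and `M'` be the gluing constructions of `(A₁, A₂, s, t)` and `(A₁', A₂, u₁ ∘ s, t)`. The
category `M` has the objects of `A₁ ⊔ A₂`, contains `A₁` and `A₂` as full subcategories, has no
morphisms from `A₂` to `A₁`, and a morphism `a ⟶ b` with `a ∈ A₁`, `b ∈ A₂` is uniquely a composite
`a ⟶ s k ⟶ t k ⟶ b`. This explicit category is `Collage s t`; that it is the pushout is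
`Collage.isPushout`.

Fix a derivator `D`. A morphism `ε : F^* Y ⟶ X` exhibits `Y` as the right Kan extension of `X` along
`F` (`IsRan`) if `F^*(-) ≫ ε` is bijective on morphisms into `Y`. By (Der4) and (Der2) this may be
tested on the slices `(b/F)` (`isRan_iff_pointwise`). Limits may be computed after restriction
along a left adjoint (`isRan_pull_of_isLeftAdjoint`), so a square `F₁ ⋙ k ⟶ j ⋙ F` preserves right
Kan extensions as soon as the induced functors `(b/F₁) ⥤ (k b/F)` are left adjoints
(`IsRan.pull_of_isLeftAdjoint`).

Suppose that `F : A ⥤ B` is covered by such squares, in the sense that every object of `A` and of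
`B` comes from one of the squares (`ExactCover`), and that all the restrictions `F'ᵢ^*` are fully
faithful. Unit and counit of `F^* ⊣ F_*` can be tested on the cover, so `F^*` is fully faithful, and
`X` lies in its essential image if and only if each `jᵢ^* X` lies in that of `F'ᵢ^*`
(`ExactCover.full_faithful`, `ExactCover.essImage_iff`).

This is used three times. The functor `u : M ⥤ M'` is covered by `u₁` and `𝟭 A₂`
(`Collage.exactCover`): for `b ∈ A₁'`, the right adjoint of `(b/u₁) ⥤ (b/u)` sends an object
`b ⟶ u₁ (s k) ⟶ t k ⟶ a` to `b ⟶ u₁ (s k)`. An arbitrary gluing construction is covered by the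
explicit one (`FreeOrientedGluing.exactCover`). Finally `F × C` is covered by copies of `F`, one for
each object of `C` (`prodCover`), which reduces the statement about the shifted prederivators to the
unshifted one, applied to the values at the objects of `C`.
-/

/-! ### Calculus of restriction functors -/

namespace Prederivator

variable (D : Prederivator.{u, v, w})
variable {A B C E : Type u} [SmallCategory A] [SmallCategory B] [SmallCategory C] [SmallCategory E]

theorem res_comp (F : A ⥤ B) (G : B ⥤ C) : D.res (F ⋙ G) = D.res G ⋙ D.res F :=
  congrArg Cat.Hom.toFunctor (D.map_comp G.toCatHom.op F.toCatHom.op)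

theorem res_id : D.res (𝟭 A) = 𝟭 (D.Diag A) :=
  congrArg Cat.Hom.toFunctor (D.map_id (op (Cat.of A)))

theorem res_obj_comp (F : A ⥤ B) (G : B ⥤ C) (X : D.Diag C) :
    (D.res (F ⋙ G)).obj X = (D.res F).obj ((D.res G).obj X) :=
  congrArg (fun H : D.Diag C ⥤ D.Diag A => H.obj X) (D.res_comp F G)

theorem res_obj_id (X : D.Diag A) : (D.res (𝟭 A)).obj X = X :=
  congrArg (fun H : D.Diag A ⥤ D.Diag A => H.obj X) D.res_id

theorem resComp_hom_app (F : A ⥤ B) (G : B ⥤ C) (X : D.Diag C) :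
    (D.resComp F G).hom.app X = eqToHom (D.res_obj_comp F G X) :=
  eqToHom_app (D.res_comp F G) X

theorem resComp_inv_app (F : A ⥤ B) (G : B ⥤ C) (X : D.Diag C) :
    (D.resComp F G).inv.app X = eqToHom (D.res_obj_comp F G X).symm :=
  eqToHom_app (D.res_comp F G).symm X

theorem resMap_id (F : A ⥤ B) : D.resMap (𝟙 F) = 𝟙 (D.res F) :=
  congrArg Cat.Hom₂.toNatTrans (D.map₂_id F.toCatHom.op)

theorem resMap_comp {F G H : A ⥤ B} (α : F ⟶ G) (β : G ⟶ H) :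
    D.resMap (α ≫ β) = D.resMap α ≫ D.resMap β :=
  congrArg Cat.Hom₂.toNatTrans (D.map₂_comp (op2 α.toCatHom₂) (op2 β.toCatHom₂))

instance {F G : A ⥤ B} (α : F ⟶ G) [IsIso α] : IsIso (D.resMap α) :=
  ⟨D.resMap (inv α), by simp [← resMap_comp, resMap_id], by simp [← resMap_comp, resMap_id]⟩

theorem resMap_app_comp_resMap_app {F G H : A ⥤ B} (α : F ⟶ G) (β : G ⟶ H) (X : D.Diag B) :
    (D.resMap α).app X ≫ (D.resMap β).app X = (D.resMap (α ≫ β)).app X := by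
  simp [resMap_comp]

theorem resMap_whiskerLeft_app (H : A ⥤ B) {F G : B ⥤ C} (α : F ⟶ G) (X : D.Diag C) :
    (D.resMap (Functor.whiskerLeft H α)).app X =
      eqToHom (D.res_obj_comp H F X) ≫ (D.res H).map ((D.resMap α).app X) ≫
        eqToHom (D.res_obj_comp H G X).symm := by
  have h := D.map₂_whisker_right (op2 α.toCatHom₂) H.toCatHom.op
  rw [D.mapComp_eq_eqToIso, D.mapComp_eq_eqToIso] at h
  have h' := congrArg (fun β => (Cat.Hom₂.toNatTrans β).app X) h
  refine h'.trans ?_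
  simp
  rfl

theorem res_map_resMap_app (H : A ⥤ B) {F G : B ⥤ C} (α : F ⟶ G) (X : D.Diag C) :
    (D.res H).map ((D.resMap α).app X) =
      eqToHom (D.res_obj_comp H F X).symm ≫ (D.resMap (Functor.whiskerLeft H α)).app X ≫
        eqToHom (D.res_obj_comp H G X) := by
  simp [resMap_whiskerLeft_app]

theorem resMap_whiskerRight_app {F G : A ⥤ B} (α : F ⟶ G) (H : B ⥤ C) (X : D.Diag C) :
    (D.resMap (Functor.whiskerRight α H)).app X =
      eqToHom (D.res_obj_comp F H X) ≫ (D.resMap α).app ((D.res H).obj X) ≫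
        eqToHom (D.res_obj_comp G H X).symm := by
  have h := D.map₂_whisker_left H.toCatHom.op (op2 α.toCatHom₂)
  rw [D.mapComp_eq_eqToIso, D.mapComp_eq_eqToIso] at h
  have h' := congrArg (fun β => (Cat.Hom₂.toNatTrans β).app X) h
  refine h'.trans ?_
  simp
  rfl

theorem resMap_app_res_obj {F G : A ⥤ B} (α : F ⟶ G) (H : B ⥤ C) (X : D.Diag C) :
    (D.resMap α).app ((D.res H).obj X) =
      eqToHom (D.res_obj_comp F H X).symm ≫ (D.resMap (Functor.whiskerRight α H)).app X ≫
        eqToHom (D.res_obj_comp G H X) := by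
  simp [resMap_whiskerRight_app]

/-! ### Restriction along adjoint functors -/

/-- The unit of the adjunction `P^* ⊣ K^*` induced by `K ⊣ P`. -/
def resUnit {K : A ⥤ B} {P : B ⥤ A} (adj : K ⊣ P) : 𝟭 (D.Diag A) ⟶ D.res P ⋙ D.res K :=
  eqToHom D.res_id.symm ≫ D.resMap adj.unit ≫ (D.resComp K P).hom

/-- The counit of the adjunction `P^* ⊣ K^*` induced by `K ⊣ P`. -/
def resCounit {K : A ⥤ B} {P : B ⥤ A} (adj : K ⊣ P) : D.res K ⋙ D.res P ⟶ 𝟭 (D.Diag B) :=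
  (D.resComp P K).inv ≫ D.resMap adj.counit ≫ eqToHom D.res_id

theorem resUnit_app {K : A ⥤ B} {P : B ⥤ A} (adj : K ⊣ P) (X : D.Diag A) :
    (D.resUnit adj).app X = eqToHom (D.res_obj_id X).symm ≫ (D.resMap adj.unit).app X ≫
      eqToHom (D.res_obj_comp K P X) := by
  simp [resUnit, resComp_hom_app, eqToHom_app]

theorem resCounit_app {K : A ⥤ B} {P : B ⥤ A} (adj : K ⊣ P) (X : D.Diag B) :
    (D.resCounit adj).app X = eqToHom (D.res_obj_comp P K X).symm ≫
      (D.resMap adj.counit).app X ≫ eqToHom (D.res_obj_id X) := by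
  simp [resCounit, resComp_inv_app, eqToHom_app]

/-- A prederivator reverses functors but not transformations, so it sends an adjunction `K ⊣ P` to
an adjunction `P^* ⊣ K^*`. -/
def resAdjunction {K : A ⥤ B} {P : B ⥤ A} (adj : K ⊣ P) : D.res P ⊣ D.res K :=
  Adjunction.mkOfUnitCounit {
    unit := D.resUnit adj
    counit := D.resCounit adj
    left_triangle := by
      ext X
      have h : Functor.whiskerLeft P adj.unit ≫ Functor.whiskerRight adj.counit P = 𝟙 P := by
        ext
        simp
      have hX := (D.resMap_app_comp_resMap_app (Functor.whiskerLeft P adj.unit)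
        (Functor.whiskerRight adj.counit P) X).trans
          ((congrArg (fun α => (D.resMap α).app X) h).trans
            (congrArg (fun α => α.app X) (D.resMap_id P)))
      simp [resUnit_app, resCounit_app, res_map_resMap_app, resMap_app_res_obj, eqToHom_map]
      exact hX
    right_triangle := by
      ext X
      have h : Functor.whiskerRight adj.unit K ≫ Functor.whiskerLeft K adj.counit = 𝟙 K := by
        ext
        simp
      have hX := (D.resMap_app_comp_resMap_app (Functor.whiskerRight adj.unit K)
        (Functor.whiskerLeft K adj.counit) X).trans
          ((congrArg (fun α => (D.resMap α).app X) h).trans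
            (congrArg (fun α => α.app X) (D.resMap_id K)))
      simp [resUnit_app, resCounit_app, res_map_resMap_app, resMap_app_res_obj, eqToHom_map]
      exact hX }

end Prederivator

namespace Prederivator

variable {D : Prederivator.{u, v, w}}
variable {A B C E : Type u} [SmallCategory A] [SmallCategory B] [SmallCategory C] [SmallCategory E]

/-! ### Right Kan extensions -/

/-- The morphism `ε : F^* Y ⟶ X` exhibits `Y` as a right Kan extension of `X` along `F`: it is a
universal arrow from `F^*` to `X`. -/
def IsRan (F : A ⥤ B) {Y : D.Diag B} {X : D.Diag A} (ε : (D.res F).obj Y ⟶ X) : Prop :=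
  ∀ Z : D.Diag B, Function.Bijective fun g : Z ⟶ Y => (D.res F).map g ≫ ε

theorem isRan_counit {F : A ⥤ B} {R : D.Diag A ⥤ D.Diag B} (adj : D.res F ⊣ R) (X : D.Diag A) :
    IsRan F (Y := R.obj X) (X := X) (adj.counit.app X) := by
  intro Z
  have h : (fun g : Z ⟶ R.obj X => (D.res F).map g ≫ adj.counit.app X) =
      (adj.homEquiv Z X).symm := funext fun g => (adj.homEquiv_counit ..).symm
  exact h ▸ (adj.homEquiv Z X).symm.bijective

/-- Two right Kan extensions of the same object are uniquely isomorphic. -/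
theorem IsRan.isIso_of_comp {F : A ⥤ B} {Y Y' : D.Diag B} {X : D.Diag A}
    {ε : (D.res F).obj Y ⟶ X} {ε' : (D.res F).obj Y' ⟶ X} (hε : IsRan F ε) (hε' : IsRan F ε')
    (h : Y' ⟶ Y) (w : (D.res F).map h ≫ ε = ε') : IsIso h := by
  obtain ⟨k, hk⟩ := (hε' Y).2 ε
  dsimp only at hk
  refine ⟨k, (hε' Y').1 ?_, (hε Y).1 ?_⟩
  · simp [hk, w]
  · simp [hk, w]

theorem IsRan.precomp {F : A ⥤ B} {Y Y' : D.Diag B} {X : D.Diag A}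
    {ε : (D.res F).obj Y ⟶ X} (hε : IsRan F ε) (h : Y' ⟶ Y) [IsIso h] :
    IsRan F ((D.res F).map h ≫ ε) := by
  intro Z
  have h1 : Function.Bijective fun g : Z ⟶ Y' => g ≫ h :=
    ((asIso h).homToEquiv (Z := Z)).bijective
  convert (hε Z).comp h1 using 2
  simp

theorem IsRan.postcomp {F : A ⥤ B} {Y : D.Diag B} {X X' : D.Diag A}
    {ε : (D.res F).obj Y ⟶ X} (hε : IsRan F ε) (h : X ⟶ X') [IsIso h] :
    IsRan F (ε ≫ h) := by
  intro Z
  have h1 : Function.Bijective fun g : (D.res F).obj Z ⟶ X => g ≫ h :=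
    ((asIso h).homToEquiv (Z := (D.res F).obj Z)).bijective
  convert h1.comp (hε Z) using 2
  simp

theorem isRan_precomp_iff {F : A ⥤ B} {Y Y' : D.Diag B} {X : D.Diag A}
    (ε : (D.res F).obj Y ⟶ X) (h : Y' ⟶ Y) [IsIso h] :
    IsRan F ((D.res F).map h ≫ ε) ↔ IsRan F ε :=
  ⟨fun H => by simpa using H.precomp (inv h), fun H => H.precomp h⟩

theorem isRan_postcomp_iff {F : A ⥤ B} {Y : D.Diag B} {X X' : D.Diag A}
    (ε : (D.res F).obj Y ⟶ X) (h : X ⟶ X') [IsIso h] :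
    IsRan F (ε ≫ h) ↔ IsRan F ε :=
  ⟨fun H => by simpa using H.postcomp (inv h), fun H => H.postcomp h⟩

/-- If `F^*` is fully faithful, then `Y` is the right Kan extension of `F^* Y`. -/
theorem isRan_of_isIso {F : A ⥤ B} [(D.res F).Full] [(D.res F).Faithful] {Y : D.Diag B}
    {X : D.Diag A} (ε : (D.res F).obj Y ⟶ X) [IsIso ε] : IsRan F ε := by
  have h : IsRan F (𝟙 ((D.res F).obj Y)) := by
    intro Z
    exact ⟨fun a b hab => (D.res F).map_injective (by simpa using hab),
      fun g => ⟨(D.res F).preimage g, by simp⟩⟩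
  simpa using h.postcomp ε

/-! ### Pulling back along a square -/

section Pull

variable {p : E ⥤ A} {v : A ⥤ C} {q : E ⥤ B} {w : B ⥤ C} (α : p ⋙ v ⟶ q ⋙ w)

/-- The pullback of `ε : w^* Y ⟶ X` along a square `α : p ⋙ v ⟶ q ⋙ w`, that is, the composite
`p^* v^* Y ⟶ q^* w^* Y ⟶ q^* X`. -/
def pull {Y : D.Diag C} {X : D.Diag B} (ε : (D.res w).obj Y ⟶ X) :
    (D.res p).obj ((D.res v).obj Y) ⟶ (D.res q).obj X :=
  (D.squareMap α).app Y ≫ (D.res q).map ε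

theorem res_map_comp_pull {Y Y' : D.Diag C} {X : D.Diag B} (h : Y' ⟶ Y)
    (ε : (D.res w).obj Y ⟶ X) :
    (D.res p).map ((D.res v).map h) ≫ pull α ε = pull α ((D.res w).map h ≫ ε) := by
  have := (D.squareMap α).naturality h
  simp only [Functor.comp_map] at this
  simp [pull, reassoc_of% this]

theorem pull_eq {Y : D.Diag C} {X : D.Diag B} (ε : (D.res w).obj Y ⟶ X) :
    pull α ε = eqToHom (D.res_obj_comp p v Y).symm ≫ (D.resMap α).app Y ≫
      eqToHom (D.res_obj_comp q w Y) ≫ (D.res q).map ε := by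
  simp [pull, squareMap, resComp_inv_app, resComp_hom_app]

instance [IsIso α] : IsIso (D.squareMap α) := by
  unfold squareMap
  infer_instance

/-- Replacing the functor `v` of a square by an equal one changes the pullback only by a canonical
isomorphism. -/
theorem pull_congr {v' : A ⥤ C} (h : v' = v) {Y : D.Diag C} {X : D.Diag B}
    (ε : (D.res w).obj Y ⟶ X) :
    pull (v := v') (eqToHom (by rw [h]) ≫ α) ε =
      (D.res p).map (eqToHom (by rw [h])) ≫ pull α ε := by
  subst h
  simp

/-- Pulling back twice agrees, up to canonical isomorphisms, with pulling back along the pasted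
square. -/
theorem pull_pull {A' E' : Type u} [SmallCategory A'] [SmallCategory E'] {p' : E' ⥤ A'}
    {v' : A' ⥤ A} {q' : E' ⥤ E} (α' : p' ⋙ v' ⟶ q' ⋙ p) {Y : D.Diag C} {X : D.Diag B}
    (ε : (D.res w).obj Y ⟶ X) :
    (D.res p').map (eqToHom (D.res_obj_comp v' v Y)) ≫ pull α' (pull α ε) =
      pull (p := p') (v := v' ⋙ v) (q := q' ⋙ q)
        (Functor.whiskerRight α' v ≫ Functor.whiskerLeft q' α) ε ≫
          eqToHom (D.res_obj_comp q' q X) := by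
  have h : (D.res (q' ⋙ q)).map ε ≫ eqToHom (D.res_obj_comp q' q X) =
      eqToHom (D.res_obj_comp q' q _) ≫ (D.res q').map ((D.res q).map ε) := by
    have := (D.resComp q' q).hom.naturality ε
    rw [resComp_hom_app, resComp_hom_app] at this
    exact this
  have h' := D.resMap_app_comp_resMap_app (Functor.whiskerRight α' v)
    (Functor.whiskerLeft q' α) Y
  simp only [pull_eq, Category.assoc, h, ← h']
  simp [res_map_resMap_app, resMap_app_res_obj, eqToHom_map]

theorem isRan_pull_pull_iff {A' E' : Type u} [SmallCategory A'] [SmallCategory E'] {p' : E' ⥤ A'}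
    {v' : A' ⥤ A} {q' : E' ⥤ E} (α' : p' ⋙ v' ⟶ q' ⋙ p) {Y : D.Diag C} {X : D.Diag B}
    (ε : (D.res w).obj Y ⟶ X) :
    IsRan p' (pull α' (pull α ε)) ↔
      IsRan p' (pull (p := p') (v := v' ⋙ v) (q := q' ⋙ q)
        (Functor.whiskerRight α' v ≫ Functor.whiskerLeft q' α) ε) := by
  rw [← isRan_precomp_iff _ (eqToHom (D.res_obj_comp v' v Y)), pull_pull, isRan_postcomp_iff]

theorem isRan_pull_congr_iff {v' : A ⥤ C} (h : v' = v) {Y : D.Diag C} {X : D.Diag B}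
    (ε : (D.res w).obj Y ⟶ X) :
    IsRan p (pull (v := v') (eqToHom (by rw [h]) ≫ α) ε) ↔ IsRan p (pull α ε) := by
  rw [pull_congr α h, isRan_precomp_iff]

end Pull

/-! ### Pointwise right Kan extensions and exact squares -/

theorem isIso_res_map_comp_iff (F : A ⥤ B) (G : B ⥤ C) {X Y : D.Diag C} (f : X ⟶ Y) :
    IsIso ((D.res (F ⋙ G)).map f) ↔ IsIso ((D.res F).map ((D.res G).map f)) :=
  NatIso.isIso_map_iff (D.resComp F G) f

/-- (Der4) in terms of universal arrows: the value at `b` of a right Kan extension is a limit over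
the slice `(b/F)`. -/
theorem isRan_pull_sliceUnder_counit (hD : D.IsDerivator) {F : A ⥤ B}
    {R : D.Diag A ⥤ D.Diag B} (adj : D.res F ⊣ R) (X : D.Diag A) (b : B) :
    IsRan (Functor.star.{u} (StructuredArrow b F))
      (pull (sliceUnder F b) (Y := R.obj X) (X := X) (adj.counit.app X)) := by
  have := hD.der3_right _ _ (Functor.star.{u} (StructuredArrow b F))
  have adjπ := Adjunction.ofIsLeftAdjoint (D.res (Functor.star.{u} (StructuredArrow b F)))
  have hiso := hD.der4_right _ _ F b R adj _ adjπ
  have h := mateEquiv_counit adj adjπ (.mk _ _ _ _ (D.squareMap (sliceUnder F b))) X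
  have h' : pull (sliceUnder F b) (Y := R.obj X) (X := X) (adj.counit.app X) =
      (D.res _).map ((D.rightMate F b adj adjπ).app X) ≫ adjπ.counit.app _ := h.symm
  rw [h']
  exact (isRan_counit adjπ _).precomp _

/-- A morphism exhibits a right Kan extension if and only if it does so pointwise. -/
theorem isRan_iff_pointwise (hD : D.IsDerivator) {F : A ⥤ B} {Y : D.Diag B} {X : D.Diag A}
    (ε : (D.res F).obj Y ⟶ X) :
    IsRan F ε ↔ ∀ b, IsRan (Functor.star.{u} (StructuredArrow b F)) (pull (sliceUnder F b) ε) := by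
  have := hD.der3_right _ _ F
  have adj := Adjunction.ofIsLeftAdjoint (D.res F)
  -- Compare `ε` with the right Kan extension provided by (Der3).
  obtain ⟨h, hh⟩ := (isRan_counit adj X Y).2 ε
  dsimp only at hh
  have key : ∀ b, (D.res (Functor.star.{u} (StructuredArrow b F))).map ((D.eval b).map h) ≫
      pull (sliceUnder F b) (adj.counit.app X) = pull (sliceUnder F b) ε := fun b => by
    rw [res_map_comp_pull, hh]
  constructor
  · intro hε b
    have := (isRan_counit adj X).isIso_of_comp hε h hh
    rw [← key]
    exact (isRan_pull_sliceUnder_counit hD adj X b).precomp _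
  · intro H
    have : IsIso h := (hD.der2 _ h).2 fun b =>
      (isRan_pull_sliceUnder_counit hD adj X b).isIso_of_comp (H b) _ (key b)
    rw [← hh]
    exact (isRan_counit adj X).precomp h

/-- Restriction along a left adjoint `K` is bijective on cones, i.e. on morphisms out of a constant
diagram: with `P` the right adjoint of `K`, it is the bijection of `P^* ⊣ K^*` up to the
identification of `P^*` of a constant diagram with a constant diagram. -/
theorem bijective_res_map_of_isLeftAdjoint (K : A ⥤ B) [K.IsLeftAdjoint] (W : D.Diag Pt.{u})
    (Z : D.Diag B) :
    Function.Bijective fun f : (D.res (Functor.star.{u} B)).obj W ⟶ Z => (D.res K).map f := by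
  let adj₀ := Adjunction.ofIsLeftAdjoint K
  let adj := D.resAdjunction adj₀
  let V := (D.res (Functor.star.{u} A)).obj W
  let e : (D.res K.rightAdjoint).obj V ≅ (D.res (Functor.star.{u} B)).obj W :=
    eqToIso ((D.res_obj_comp _ _ W).symm.trans
      (by rw [Functor.punit_ext' (K.rightAdjoint ⋙ Functor.star.{u} A) (Functor.star.{u} B)]))
  -- The unit at a constant diagram comes from a transformation between functors to `Pt`.
  have hu : IsIso (adj.unit.app V) := by
    change IsIso ((D.resUnit adj₀).app V)
    rw [resUnit_app, resMap_app_res_obj]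
    have (X : A) : IsIso ((Functor.whiskerRight adj₀.unit (Functor.star.{u} A)).app X) :=
      inferInstance
    have := NatIso.isIso_of_isIso_app (Functor.whiskerRight adj₀.unit (Functor.star.{u} A))
    infer_instance
  have h1 : Function.Bijective
      fun f : (D.res (Functor.star.{u} B)).obj W ⟶ Z => adj.homEquiv V Z (e.hom ≫ f) :=
    (adj.homEquiv V Z).bijective.comp (e.symm.homFromEquiv (Z := Z)).bijective
  have h2 : Function.Bijective fun g : (D.res K).obj ((D.res (Functor.star.{u} B)).obj W) ⟶
      (D.res K).obj Z => (adj.unit.app V ≫ (D.res K).map e.hom) ≫ g :=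
    ((asIso (adj.unit.app V ≫ (D.res K).map e.hom)).symm.homFromEquiv
      (Z := (D.res K).obj Z)).bijective
  refine (Function.Bijective.of_comp_iff' h2 _).1 ?_
  refine (congrArg _ (funext fun f => ?_)).mp h1
  simp [Adjunction.homEquiv_unit]

/-- Left adjoints are homotopy initial: limits can be computed after restriction along them. -/
theorem isRan_pull_of_isLeftAdjoint (K : A ⥤ B) [K.IsLeftAdjoint]
    (ψ : Functor.star.{u} A ⋙ 𝟭 Pt.{u} ⟶ K ⋙ Functor.star.{u} B) {V : D.Diag Pt.{u}}
    {Z : D.Diag B} {ε : (D.res (Functor.star.{u} B)).obj V ⟶ Z} :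
    IsRan (Functor.star.{u} A) (pull ψ ε) ↔ IsRan (Functor.star.{u} B) ε := by
  have : IsIso ψ := by
    have (X : A) : IsIso (ψ.app X) := inferInstance
    exact NatIso.isIso_of_isIso_app ψ
  have : (D.res (𝟭 Pt.{u})).IsEquivalence := by rw [D.res_id]; infer_instance
  have h0 (W : D.Diag Pt.{u}) : Function.Bijective fun g : W ⟶ V => (D.res (𝟭 Pt.{u})).map g :=
    ⟨(D.res (𝟭 Pt.{u})).map_injective, (D.res (𝟭 Pt.{u})).map_surjective⟩
  have h2 (W : D.Diag Pt.{u}) : Function.Bijective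
      fun g : (D.res K).obj ((D.res (Functor.star.{u} B)).obj W) ⟶
        (D.res K).obj Z => (D.squareMap ψ).app W ≫ g :=
    ((asIso ((D.squareMap ψ).app W)).symm.homFromEquiv
      (Z := (D.res K).obj Z)).bijective
  have key (W : D.Diag Pt.{u}) :
      (Function.Bijective fun g : (D.res (𝟭 Pt.{u})).obj W ⟶ (D.res (𝟭 Pt.{u})).obj V =>
        (D.res (Functor.star.{u} A)).map g ≫ pull ψ ε) ↔
      Function.Bijective fun g : W ⟶ V => (D.res (Functor.star.{u} B)).map g ≫ ε := by
    rw [← Function.Bijective.of_comp_iff _ (h0 W),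
      ← Function.Bijective.of_comp_iff' (bijective_res_map_of_isLeftAdjoint K W Z),
      ← Function.Bijective.of_comp_iff' (h2 W)]
    refine iff_of_eq (congrArg _ (funext fun g => ?_))
    simp only [Function.comp_apply]
    rw [res_map_comp_pull]
    rfl
  constructor
  · exact fun h W => (key W).1 (h _)
  · intro h W
    have := (key W).2 (h W)
    rwa [D.res_obj_id W] at this

end Prederivator

namespace Prederivator

variable {D : Prederivator.{u, v, w}}
variable {A B A₁ B₁ : Type u} [SmallCategory A] [SmallCategory B] [SmallCategory A₁]
  [SmallCategory B₁]

/-- Right Kan extensions are preserved by squares for which the induced functors `(b/F₁) ⥤ (j' b/F)`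
are left adjoints. -/
theorem IsRan.pull_of_isLeftAdjoint (hD : D.IsDerivator) {F₁ : A₁ ⥤ B₁} {j' : B₁ ⥤ B}
    {j : A₁ ⥤ A} {F : A ⥤ B} (φ : F₁ ⋙ j' ⟶ j ⋙ F)
    (hφ : ∀ b, (StructuredArrow.map₂ (𝟙 (j'.obj b)) φ).IsLeftAdjoint)
    {Y : D.Diag B} {X : D.Diag A} {ε : (D.res F).obj Y ⟶ X} (hε : IsRan F ε) :
    IsRan F₁ (pull φ ε) := by
  refine (isRan_iff_pointwise hD _).2 fun b => ?_
  have := hφ b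
  let K := StructuredArrow.map₂ (𝟙 (j'.obj b)) φ
  let ψ : Functor.star.{u} (StructuredArrow b F₁) ⋙ 𝟭 Pt.{u} ⟶
    K ⋙ Functor.star.{u} (StructuredArrow (j'.obj b) F) := 𝟙 _
  -- The slice square of `F` at `j' b` restricted along `K` is the pasting of the slice square of
  -- `F₁` at `b` with `φ`.
  have h1 : IsRan (Functor.star.{u} (StructuredArrow b F₁))
      (pull ψ (pull (sliceUnder F (j'.obj b)) ε)) :=
    (isRan_pull_of_isLeftAdjoint K ψ).2 ((isRan_iff_pointwise hD ε).1 hε _)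
  have hpt : 𝟭 Pt.{u} ⋙ point (j'.obj b) = point b ⋙ j' :=
    CategoryTheory.Functor.ext (fun _ => rfl) (fun _ _ _ => by simp)
  have e : (Functor.whiskerRight ψ (point (j'.obj b)) ≫
      Functor.whiskerLeft K (sliceUnder F (j'.obj b))) =
      eqToHom (congrArg (Functor.star.{u} (StructuredArrow b F₁) ⋙ ·) hpt) ≫
        Functor.whiskerRight (sliceUnder F₁ b) j' ≫
          Functor.whiskerLeft (StructuredArrow.proj b F₁) φ := by
    ext x
    simp [eqToHom_app, ψ, K, sliceUnder]
    exact Category.id_comp _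
  rw [isRan_pull_pull_iff, e] at h1
  rw [isRan_pull_pull_iff]
  exact (isRan_pull_congr_iff _ hpt _).1 h1

/-- A criterion for the functor `(b/F₁) ⥤ (j' b/F)` induced by a square to be a left adjoint: every
object of `(j' b/F)` has a terminal approximation by an object of `(b/F₁)`. -/
theorem isLeftAdjoint_map₂ {F₁ : A₁ ⥤ B₁} {j' : B₁ ⥤ B} {j : A₁ ⥤ A}
    {F : A ⥤ B} (φ : F₁ ⋙ j' ⟶ j ⋙ F) (b : B₁)
    (H : ∀ (a : A) (f : j'.obj b ⟶ F.obj a), ∃ (x : A₁) (g : b ⟶ F₁.obj x) (k : j.obj x ⟶ a),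
      j'.map g ≫ φ.app x ≫ F.map k = f ∧
      ∀ (x' : A₁) (g' : b ⟶ F₁.obj x') (k' : j.obj x' ⟶ a),
        j'.map g' ≫ φ.app x' ≫ F.map k' = f →
          ∃! m : x' ⟶ x, g' ≫ F₁.map m = g ∧ j.map m ≫ k = k') :
    (StructuredArrow.map₂ (𝟙 (j'.obj b)) φ).IsLeftAdjoint := by
  have : ∀ S, Limits.HasTerminal (CostructuredArrow (StructuredArrow.map₂ (𝟙 (j'.obj b)) φ) S) := by
    intro S
    obtain ⟨x, g, k, h, hu⟩ := H S.right S.hom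
    let T : CostructuredArrow (StructuredArrow.map₂ (𝟙 (j'.obj b)) φ) S :=
      CostructuredArrow.mk (Y := StructuredArrow.mk g) (StructuredArrow.homMk k (by simpa using h))
    have key : ∀ Q : CostructuredArrow (StructuredArrow.map₂ (𝟙 (j'.obj b)) φ) S,
        ∃! m : Q.left.right ⟶ x, Q.left.hom ≫ F₁.map m = g ∧ j.map m ≫ k = Q.hom.right := by
      intro Q
      apply hu
      simpa using StructuredArrow.w Q.hom
    have (Q : CostructuredArrow (StructuredArrow.map₂ (𝟙 (j'.obj b)) φ) S) : Unique (Q ⟶ T) :=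
      { default := CostructuredArrow.homMk (StructuredArrow.homMk (key Q).choose
          (key Q).choose_spec.1.1) (by ext; exact (key Q).choose_spec.1.2)
        uniq := fun m => by
          ext
          refine (key Q).choose_spec.2 _ ⟨?_, ?_⟩
          · exact StructuredArrow.w m.left
          · exact congrArg CommaMorphism.right (CostructuredArrow.w m) }
    exact Limits.hasTerminal_of_unique T
  exact isLeftAdjoint_of_costructuredArrowTerminals _

end Prederivator

namespace Prederivator

variable {D : Prederivator.{u, v, w}}
variable {A B : Type u} [SmallCategory A] [SmallCategory B]

/-! ### Exact covers -/

/-- A family of squares `F' i ⋙ k i ≅ j i ⋙ F` along which right Kan extensions can be computed and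
which covers the objects of the source and of the target of `F`. -/
structure ExactCover {ι : Type*} (F : A ⥤ B) {A' B' : ι → Type u} [∀ i, SmallCategory (A' i)]
    [∀ i, SmallCategory (B' i)] (F' : ∀ i, A' i ⥤ B' i) (j : ∀ i, A' i ⥤ A)
    (k : ∀ i, B' i ⥤ B) where
  /-- The invertible transformations filling the squares. -/
  φ : ∀ i, F' i ⋙ k i ≅ j i ⋙ F
  exact : ∀ i b, (StructuredArrow.map₂ (𝟙 ((k i).obj b)) (φ i).hom).IsLeftAdjoint
  source : ∀ a, ∃ i x, (j i).obj x = a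
  target : ∀ b, ∃ i x, (k i).obj x = b

/-- By (Der2), isomorphisms are detected on any family of functors covering the objects. -/
theorem isIso_of_cover (hD : D.IsDerivator) {ι : Type*} {A' : ι → Type u}
    [∀ i, SmallCategory (A' i)] (j : ∀ i, A' i ⥤ A) (hj : ∀ a, ∃ i x, (j i).obj x = a)
    {X Y : D.Diag A} (f : X ⟶ Y) (h : ∀ i, IsIso ((D.res (j i)).map f)) : IsIso f := by
  refine (hD.der2 _ f).2 fun a => ?_
  obtain ⟨i, x, rfl⟩ := hj a
  have := h i
  have hpt : point ((j i).obj x) = point x ⋙ j i :=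
    CategoryTheory.Functor.ext (fun _ => rfl) (fun _ _ _ => by simp)
  rw [eval, hpt, isIso_res_map_comp_iff]
  infer_instance

theorem essImage_res_obj {A' B' : Type u} [SmallCategory A'] [SmallCategory B']
    {F : A ⥤ B} {F' : A' ⥤ B'} {j : A' ⥤ A} {k : B' ⥤ B} (φ : F' ⋙ k ≅ j ⋙ F) {X : D.Diag A}
    (h : (D.res F).essImage X) : (D.res F').essImage ((D.res j).obj X) := by
  obtain ⟨Y, ⟨i⟩⟩ := h
  exact ⟨(D.res k).obj Y, ⟨(asIso (D.squareMap φ.hom)).app Y ≪≫ (D.res j).mapIso i⟩⟩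

namespace ExactCover

variable {ι : Type*} {F : A ⥤ B} {A' B' : ι → Type u} [∀ i, SmallCategory (A' i)]
    [∀ i, SmallCategory (B' i)] {F' : ∀ i, A' i ⥤ B' i} {j : ∀ i, A' i ⥤ A}
    {k : ∀ i, B' i ⥤ B} (S : ExactCover F F' j k)

include S

/-- If `R` is a right Kan extension of `X` and `h : Y ⟶ R` corresponds to an isomorphism
`F^* Y ≅ X`, then `h` is invertible: on each square of the cover both `Y` and `R` restrict to right
Kan extensions of the restriction of `X`. -/
theorem isIso_of_isIso_res_map_comp (hD : D.IsDerivator)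
    (hF : ∀ i, (D.res (F' i)).Full ∧ (D.res (F' i)).Faithful)
    {X : D.Diag A} {R : D.Diag B} {ε : (D.res F).obj R ⟶ X} (hε : IsRan F ε)
    {Y : D.Diag B} (h : Y ⟶ R) [IsIso ((D.res F).map h ≫ ε)] : IsIso h := by
  refine isIso_of_cover hD k S.target h fun i => ?_
  have := (hF i).1
  have := (hF i).2
  have h1 : IsIso (pull (S.φ i).hom ((D.res F).map h ≫ ε)) := by
    unfold pull
    infer_instance
  exact (hε.pull_of_isLeftAdjoint hD _ (S.exact i)).isIso_of_comp (isRan_of_isIso _) _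
    (res_map_comp_pull (S.φ i).hom h ε)

theorem full_faithful (hD : D.IsDerivator)
    (hF : ∀ i, (D.res (F' i)).Full ∧ (D.res (F' i)).Faithful) :
    (D.res F).Full ∧ (D.res F).Faithful := by
  have := hD.der3_right _ _ F
  have adj := Adjunction.ofIsLeftAdjoint (D.res F)
  have : IsIso adj.unit := by
    have (Y : D.Diag B) : IsIso (adj.unit.app Y) := by
      have hiso : IsIso ((D.res F).map (adj.unit.app Y) ≫ adj.counit.app ((D.res F).obj Y)) := by
        rw [show _ ≫ _ = 𝟙 _ from adj.left_triangle_components Y]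
        exact IsIso.id _
      exact S.isIso_of_isIso_res_map_comp hD hF (isRan_counit adj ((D.res F).obj Y))
        (adj.unit.app Y)
    exact NatIso.isIso_of_isIso_app _
  let ff := adj.fullyFaithfulLOfIsIsoUnit
  exact ⟨ff.full, ff.faithful⟩

theorem essImage_iff (hD : D.IsDerivator)
    (hF : ∀ i, (D.res (F' i)).Full ∧ (D.res (F' i)).Faithful) (X : D.Diag A) :
    (D.res F).essImage X ↔ ∀ i, (D.res (F' i)).essImage ((D.res (j i)).obj X) := by
  refine ⟨fun h i => essImage_res_obj (S.φ i) h, fun h => ?_⟩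
  have := hD.der3_right _ _ F
  have adj := Adjunction.ofIsLeftAdjoint (D.res F)
  have : IsIso (adj.counit.app X) := by
    refine isIso_of_cover hD j S.source _ fun i => ?_
    have := (hF i).1
    have := (hF i).2
    have hε := (isRan_counit adj X).pull_of_isLeftAdjoint hD _ (S.exact i)
    obtain ⟨W, ⟨e⟩⟩ := h i
    obtain ⟨g, hg⟩ := (hε W).2 e.hom
    dsimp only at hg
    have : IsIso g := hε.isIso_of_comp (isRan_of_isIso e.hom) g hg
    have h1 : IsIso (pull (S.φ i).hom (Y := _) (X := X) (adj.counit.app X)) := by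
      rw [← IsIso.eq_inv_comp] at hg
      rw [hg]
      infer_instance
    unfold pull at h1
    exact IsIso.of_isIso_comp_left ((D.squareMap (S.φ i).hom).app _) _
  exact ⟨_, ⟨asIso (adj.counit.app X)⟩⟩

end ExactCover

/-- The functor `F × C` is covered by the copies `F × {c}` of `F`: the object `(a, c')` of a slice
under `(b, c)` is approximated by `a`, using the given morphism `c ⟶ c'`. -/
def prodCover (F : A ⥤ B) (C : Type u) [SmallCategory C] :
    ExactCover (F.prod (𝟭 C)) (fun _ : C => F) (fun c => Prod.sectL A c)
      (fun c => Prod.sectL B c) where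
  φ c := Iso.refl _
  exact c b := by
    refine isLeftAdjoint_map₂ _ _ fun a f => ⟨a.1, f.1, (𝟙 _, f.2), ?_, fun x' g' k' h => ?_⟩
    · refine Prod.ext ?_ ?_
      · change f.1 ≫ 𝟙 _ ≫ F.map (𝟙 _) = f.1
        simp
      · exact (Category.id_comp _).trans (Category.id_comp _)
    · have h₁ : g' ≫ 𝟙 _ ≫ F.map k'.1 = f.1 := congrArg Prod.fst h
      have h₂ : 𝟙 c ≫ 𝟙 c ≫ k'.2 = f.2 := congrArg Prod.snd h
      refine ⟨k'.1, ⟨by simpa using h₁, Prod.ext (Category.comp_id k'.1) ?_⟩, fun m hm => ?_⟩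
      · exact (Category.id_comp _).trans
          (h₂.symm.trans ((Category.id_comp _).trans (Category.id_comp _)))
      · exact (Category.comp_id m).symm.trans (congrArg Prod.fst hm.2)
  source a := ⟨a.2, a.1, rfl⟩
  target b := ⟨b.2, b.1, rfl⟩

theorem essImage_shiftRes_iff (hD : D.IsDerivator) (F : A ⥤ B)
    (hF : (D.res F).Full ∧ (D.res F).Faithful) (C : Type u) [SmallCategory C]
    (X : D.Diag (A × C)) :
    (D.shiftRes F C).essImage X ↔
      ∀ c, (D.res F).essImage ((D.res (Prod.sectL A c)).obj X) :=
  (prodCover F C).essImage_iff hD (fun _ => hF) X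

end Prederivator

/-! ### Extensionality for functors out of arrows and coproducts -/

/-- The morphism `0 ⟶ 1` of `[1]`. -/
def unitHom : (AsSmall.up.obj (0 : Fin 2) : UnitArrow.{u}) ⟶ AsSmall.up.obj 1 :=
  AsSmall.up.map (homOfLE (Fin.zero_le 1))

theorem functor_unitArrow_ext {T : Type u} [SmallCategory T] {F G : UnitArrow.{u} ⥤ T}
    (h₀ : F.obj (AsSmall.up.obj 0) = G.obj (AsSmall.up.obj 0))
    (h₁ : F.obj (AsSmall.up.obj 1) = G.obj (AsSmall.up.obj 1))
    (h : F.map unitHom = eqToHom h₀ ≫ G.map unitHom ≫ eqToHom h₁.symm) : F = G := by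
  have : AsSmall.up ⋙ F = AsSmall.up ⋙ G := ComposableArrows.ext₁ (F := AsSmall.up ⋙ F)
    (G := AsSmall.up ⋙ G) h₀ h₁ h
  exact congrArg (AsSmall.down ⋙ ·) this

theorem functor_sigma_ext {I : Type} {A T : Type u} [SmallCategory A] [SmallCategory T]
    {F G : (Σ _ : I, A) ⥤ T} (h : ∀ i, Sigma.incl i ⋙ F = Sigma.incl i ⋙ G) : F = G := by
  refine Functor.hext (fun ⟨i, X⟩ => Functor.congr_obj (h i) X) ?_
  rintro ⟨i, X⟩ ⟨_, Y⟩ ⟨f⟩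
  exact Functor.hcongr_hom (h i) f

theorem functor_sum_ext {A₁ A₂ T : Type u} [SmallCategory A₁] [SmallCategory A₂]
    [SmallCategory T] {F G : A₁ ⊕ A₂ ⥤ T}
    (h₁ : Sum.inl_ A₁ A₂ ⋙ F = Sum.inl_ A₁ A₂ ⋙ G)
    (h₂ : Sum.inr_ A₁ A₂ ⋙ F = Sum.inr_ A₁ A₂ ⋙ G) : F = G := by
  refine Functor.hext ?_ ?_
  · rintro (X | X)
    · exact Functor.congr_obj h₁ X
    · exact Functor.congr_obj h₂ X
  · intro X Y f
    induction f using Sum.homInduction with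
    | inl x y f => exact Functor.hcongr_hom h₁ f
    | inr x y f => exact Functor.hcongr_hom h₂ f

theorem functor_pt_ext {T : Type u} [SmallCategory T] {F G : Prederivator.Pt.{u} ⥤ T}
    (h : F.obj ⟨⟨⟩⟩ = G.obj ⟨⟨⟩⟩) : F = G := by
  refine CategoryTheory.Functor.ext (fun _ => h) ?_
  rintro ⟨⟨⟩⟩ ⟨⟨⟩⟩ ⟨⟨⟨⟩⟩⟩
  exact (F.map_id _).trans (by simp)

/-! ### The explicit gluing construction -/

section Collage

variable {A₁ A₁' A₂ : Type u} [SmallCategory A₁] [SmallCategory A₁'] [SmallCategory A₂] {n : ℕ}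

/-- The explicit model of the free oriented gluing construction associated to `(A₁, A₂, s, t)`. Its
objects are those of `A₁` and those of `A₂`. -/
inductive Collage (s : Fin n → A₁) (t : Fin n → A₂) : Type u
  | left (a : A₁)
  | right (a : A₂)

namespace Collage

variable {s : Fin n → A₁} {t : Fin n → A₂}

/-- The morphisms of the collage: those of `A₁`, those of `A₂`, and, for each `k`, the formal
composites `a ⟶ s k ⟶ t k ⟶ b`. -/
inductive Hom : Collage s t → Collage s t → Type u
  | left {a b : A₁} (f : a ⟶ b) : Hom (left a) (left b)
  | right {a b : A₂} (f : a ⟶ b) : Hom (right a) (right b)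
  | cross {a : A₁} {b : A₂} (k : Fin n) (f : a ⟶ s k) (g : t k ⟶ b) : Hom (left a) (right b)

/-- Identity morphisms of the collage. -/
def Hom.id : ∀ X : Collage s t, Hom X X
  | .left a => .left (𝟙 a)
  | .right a => .right (𝟙 a)

/-- Composition of morphisms of the collage. -/
def Hom.comp : ∀ {X Y Z : Collage s t}, Hom X Y → Hom Y Z → Hom X Z
  | _, _, _, .left f, .left g => .left (f ≫ g)
  | _, _, _, .right f, .right g => .right (f ≫ g)
  | _, _, _, .left f, .cross k g h => .cross k (f ≫ g) h
  | _, _, _, .cross k g h, .right f => .cross k g (h ≫ f)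

instance : SmallCategory (Collage s t) where
  Hom := Hom
  id := Hom.id
  comp := Hom.comp
  id_comp f := by cases f <;> simp [Hom.id, Hom.comp]
  comp_id f := by cases f <;> simp [Hom.id, Hom.comp]
  assoc f g h := by cases f <;> cases g <;> cases h <;> simp [Hom.comp]

/-- The inclusion of `A₁`. -/
def inclLeft (s : Fin n → A₁) (t : Fin n → A₂) : A₁ ⥤ Collage s t where
  obj := left
  map := Hom.left
  map_id _ := rfl
  map_comp _ _ := rfl

/-- The inclusion of `A₂`. -/
def inclRight (s : Fin n → A₁) (t : Fin n → A₂) : A₂ ⥤ Collage s t where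
  obj := right
  map := Hom.right
  map_id _ := rfl
  map_comp _ _ := rfl

/-- The free generator `s k ⟶ t k`. -/
def gen (s : Fin n → A₁) (t : Fin n → A₂) (k : Fin n) :
    (left (s k) : Collage s t) ⟶ right (t k) :=
  Hom.cross k (𝟙 _) (𝟙 _)

theorem cross_eq {a : A₁} {b : A₂} (k : Fin n) (f : a ⟶ s k) (g : t k ⟶ b) :
    (show (left a : Collage s t) ⟶ right b from Hom.cross k f g) =
      (inclLeft s t).map f ≫ gen s t k ≫ (inclRight s t).map g := by
  change Hom.cross k f g = Hom.cross k (f ≫ 𝟙 _) (𝟙 _ ≫ g)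
  simp

/-- The functor between collages induced by `u₁ : A₁ ⥤ A₁'`. -/
def map (s : Fin n → A₁) (t : Fin n → A₂) (u₁ : A₁ ⥤ A₁') :
    Collage s t ⥤ Collage (fun k => u₁.obj (s k)) t where
  obj
    | .left a => .left (u₁.obj a)
    | .right a => .right a
  map
    | .left f => Hom.left (u₁.map f)
    | .right f => Hom.right f
    | .cross k f g => Hom.cross k (u₁.map f) g
  map_id X := by
    cases X
    · exact congrArg Hom.left (u₁.map_id _)
    · rfl
  map_comp {X Y Z} f g := by
    change Hom X Y at f
    change Hom Y Z at g
    cases f <;> cases g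
    · exact congrArg Hom.left (u₁.map_comp _ _)
    · exact congrArg (Hom.cross _ · _) (u₁.map_comp _ _)
    · rfl
    · rfl

/-- The strictly commutative square of inclusions of `A₁` and `A₁'`. -/
def inclLeftMapIso (s : Fin n → A₁) (t : Fin n → A₂) (u₁ : A₁ ⥤ A₁') :
    u₁ ⋙ inclLeft (fun k => u₁.obj (s k)) t ≅ inclLeft s t ⋙ map s t u₁ := Iso.refl _

/-- The strictly commutative square of inclusions of `A₂`. -/
def inclRightMapIso (s : Fin n → A₁) (t : Fin n → A₂) (u₁ : A₁ ⥤ A₁') :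
    𝟭 A₂ ⋙ inclRight (fun k => u₁.obj (s k)) t ≅ inclRight s t ⋙ map s t u₁ := Iso.refl _

/-- The slices of the collage map under objects of `A₁'`: an object of `A₁` is approximated by
itself, and an object of `A₂` under `b` via `b ⟶ u₁ (s k) ⟶ t k ⟶ a` is approximated by `s k`. -/
theorem isLeftAdjoint_map₂_inclLeft (u₁ : A₁ ⥤ A₁') (b : A₁') :
    (StructuredArrow.map₂ (𝟙 ((inclLeft (fun k => u₁.obj (s k)) t).obj b))
      (inclLeftMapIso s t u₁).hom).IsLeftAdjoint := by
  refine Prederivator.isLeftAdjoint_map₂ _ _ fun a f => ?_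
  cases a with
  | left a =>
    change Hom (left b) (left (u₁.obj a)) at f
    cases f with
    | left f =>
      refine ⟨a, f, 𝟙 _, ?_, fun x' g' k' h => ?_⟩
      · change Hom.left (f ≫ 𝟙 _ ≫ u₁.map (𝟙 _)) = _
        simp
      · change Hom (left x') (left a) at k'
        cases k' with
        | left k' =>
          have h' : g' ≫ 𝟙 _ ≫ u₁.map k' = f := Hom.left.inj h
          refine ⟨k', ⟨by simpa using h', ?_⟩, fun m hm => ?_⟩
          · exact congrArg Hom.left (Category.comp_id k')
          · exact (Category.comp_id m).symm.trans (Hom.left.inj hm.2)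
  | right a =>
    change Hom (left b) (right a) at f
    cases f with
    | cross k f g =>
      refine ⟨s k, f, Hom.cross k (𝟙 _) g, ?_, fun x' g' k' h => ?_⟩
      · exact congrArg (Hom.cross k · g) (show f ≫ 𝟙 _ ≫ u₁.map (𝟙 (s k)) = f by simp)
      · change Hom (left x') (right a) at k'
        cases k' with
        | cross k₂ f₂ g₂ =>
          obtain ⟨rfl, h₁, h₂⟩ := Hom.cross.inj h
          obtain rfl := eq_of_heq h₁
          obtain rfl := eq_of_heq h₂
          refine ⟨f₂, ⟨?_, ?_⟩, fun m hm => ?_⟩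
          · change g' ≫ u₁.map f₂ = g' ≫ 𝟙 _ ≫ u₁.map f₂
            simp
          · exact congrArg (Hom.cross _ · _) (Category.comp_id f₂)
          · exact (Category.comp_id m).symm.trans (eq_of_heq (Hom.cross.inj hm.2).2.1)

/-- The slices of the collage map under objects of `A₂` contain no objects of `A₁`. -/
theorem isLeftAdjoint_map₂_inclRight (u₁ : A₁ ⥤ A₁') (b : A₂) :
    (StructuredArrow.map₂ (𝟙 ((inclRight (fun k => u₁.obj (s k)) t).obj b))
      (inclRightMapIso s t u₁).hom).IsLeftAdjoint := by
  refine Prederivator.isLeftAdjoint_map₂ _ _ fun a f => ?_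
  cases a with
  | left a => exact nomatch (show Hom (right b) (left (u₁.obj a)) from f)
  | right a =>
    change Hom (right b) (right a) at f
    cases f with
    | right f =>
      refine ⟨a, f, 𝟙 _, ?_, fun x' g' k' h => ?_⟩
      · change Hom.right (f ≫ 𝟙 _ ≫ 𝟙 _) = _
        simp
      · change Hom (right x') (right a) at k'
        cases k' with
        | right k' =>
          have h' : g' ≫ 𝟙 _ ≫ k' = f := Hom.right.inj h
          refine ⟨k', ⟨by simpa using h', ?_⟩, fun m hm => ?_⟩
          · exact congrArg Hom.right (Category.comp_id k')
          · exact (Category.comp_id m).symm.trans (Hom.right.inj hm.2)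

/-! ### The universal property of the explicit gluing construction -/

/-- The functor `A₁ ⊔ A₂ ⥤ Collage s t`. -/
def incl (s : Fin n → A₁) (t : Fin n → A₂) : A₁ ⊕ A₂ ⥤ Collage s t :=
  (inclLeft s t).sum' (inclRight s t)

/-- The functor from the coproduct of the intervals which picks out the free generators. -/
def generators (s : Fin n → A₁) (t : Fin n → A₂) : (Σ _ : Fin n, UnitArrow.{u}) ⥤ Collage s t :=
  Sigma.desc fun k => AsSmall.down ⋙ ComposableArrows.mk₁ (gen s t k)

theorem gluing_comm (s : Fin n → A₁) (t : Fin n → A₂) :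
    gluingObjects s t ⋙ incl s t = gluingEnds.{u} n ⋙ generators s t :=
  functor_sigma_ext fun _ => functor_sum_ext (functor_pt_ext rfl) (functor_pt_ext rfl)

/-- A functor out of the collage is determined by its values on `A₁`, `A₂` and the generators, since
every other morphism is a composite of these. -/
theorem functor_ext {T : Type u} [SmallCategory T] {F G : Collage s t ⥤ T}
    (h₁ : incl s t ⋙ F = incl s t ⋙ G) (h₂ : generators s t ⋙ F = generators s t ⋙ G) : F = G := by
  have hl : inclLeft s t ⋙ F = inclLeft s t ⋙ G := congrArg (Sum.inl_ A₁ A₂ ⋙ ·) h₁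
  have hr : inclRight s t ⋙ F = inclRight s t ⋙ G := congrArg (Sum.inr_ A₁ A₂ ⋙ ·) h₁
  have hobj (X) : F.obj X = G.obj X := by
    cases X with
    | left a => exact Functor.congr_obj hl a
    | right a => exact Functor.congr_obj hr a
  refine Functor.hext hobj fun X Y f => ?_
  change Hom X Y at f
  cases f with
  | left f => exact Functor.hcongr_hom hl f
  | right f => exact Functor.hcongr_hom hr f
  | cross k f g =>
    have hg : F.map (gen s t k) ≍ G.map (gen s t k) :=
      Functor.hcongr_hom h₂ ((Sigma.incl k).map unitHom)
    have key {W X Y Z : Collage s t} (f : W ⟶ X) (g : X ⟶ Y) (h : Y ⟶ Z)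
        (hf : F.map f ≍ G.map f) (hg : F.map g ≍ G.map g) (hh : F.map h ≍ G.map h) :
        F.map (f ≫ g ≫ h) ≍ G.map (f ≫ g ≫ h) := by
      simp only [Functor.map_comp]
      exact heq_comp (hobj _) (hobj _) (hobj _) hf (heq_comp (hobj _) (hobj _) (hobj _) hg hh)
    have e : Hom.cross k f g = (inclLeft s t).map f ≫ gen s t k ≫ (inclRight s t).map g :=
      cross_eq k f g
    rw [e]
    exact key _ _ _ (Functor.hcongr_hom hl f) hg (Functor.hcongr_hom hr g)

/-- The functor out of the collage determined by its restriction to `A₁ ⊔ A₂` and by the images of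
the generators. -/
def lift {T : Type u} [SmallCategory T] (F : A₁ ⊕ A₂ ⥤ T)
    (γ : ∀ k, F.obj (Sum.inl (s k)) ⟶ F.obj (Sum.inr (t k))) : Collage s t ⥤ T where
  obj
    | .left a => F.obj (Sum.inl a)
    | .right a => F.obj (Sum.inr a)
  map
    | .left f => (Sum.inl_ A₁ A₂ ⋙ F).map f
    | .right f => (Sum.inr_ A₁ A₂ ⋙ F).map f
    | .cross k f g => (Sum.inl_ A₁ A₂ ⋙ F).map f ≫ γ k ≫ (Sum.inr_ A₁ A₂ ⋙ F).map g
  map_id X := by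
    cases X
    · exact (Sum.inl_ A₁ A₂ ⋙ F).map_id _
    · exact (Sum.inr_ A₁ A₂ ⋙ F).map_id _
  map_comp {X Y Z} f g := by
    change Hom X Y at f
    change Hom Y Z at g
    cases f <;> cases g
    · exact (Sum.inl_ A₁ A₂ ⋙ F).map_comp _ _
    · exact (congrArg (· ≫ _) ((Sum.inl_ A₁ A₂ ⋙ F).map_comp _ _)).trans (Category.assoc _ _ _)
    · exact (Sum.inr_ A₁ A₂ ⋙ F).map_comp _ _
    · have key {V W X Y Z : T} (f : V ⟶ W) (g : W ⟶ X) (h : X ⟶ Y) (i : Y ⟶ Z) :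
          f ≫ g ≫ h ≫ i = (f ≫ g ≫ h) ≫ i := by simp
      exact (congrArg (fun x => _ ≫ _ ≫ x) ((Sum.inr_ A₁ A₂ ⋙ F).map_comp _ _)).trans
        (key _ _ _ _)

theorem exists_lift {T : Type u} [SmallCategory T] (F : A₁ ⊕ A₂ ⥤ T)
    (H : (Σ _ : Fin n, UnitArrow.{u}) ⥤ T) (w : gluingObjects s t ⋙ F = gluingEnds n ⋙ H) :
    ∃ L : Collage s t ⥤ T, incl s t ⋙ L = F ∧ generators s t ⋙ L = H := by
  have e₀ (k : Fin n) : F.obj (Sum.inl (s k)) = H.obj ⟨k, AsSmall.up.obj 0⟩ :=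
    Functor.congr_obj w ⟨k, Sum.inl ⟨⟨⟩⟩⟩
  have e₁ (k : Fin n) : F.obj (Sum.inr (t k)) = H.obj ⟨k, AsSmall.up.obj 1⟩ :=
    Functor.congr_obj w ⟨k, Sum.inr ⟨⟨⟩⟩⟩
  refine ⟨lift F fun k => eqToHom (e₀ k) ≫ H.map ((Sigma.incl k).map unitHom) ≫
    eqToHom (e₁ k).symm, functor_sum_ext rfl rfl,
    functor_sigma_ext fun k => functor_unitArrow_ext (e₀ k) (e₁ k) ?_⟩
  change (Sum.inl_ A₁ A₂ ⋙ F).map (𝟙 _) ≫ _ ≫ (Sum.inr_ A₁ A₂ ⋙ F).map (𝟙 _) = _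
  rw [CategoryTheory.Functor.map_id, CategoryTheory.Functor.map_id]
  exact (Category.id_comp _).trans (Category.comp_id _)

theorem isPushout (s : Fin n → A₁) (t : Fin n → A₂) :
    IsPushout (gluingObjects s t).toCatHom (gluingEnds.{u} n).toCatHom
      (incl s t).toCatHom (generators s t).toCatHom where
  w := congrArg Functor.toCatHom (gluing_comm s t)
  isColimit' := ⟨Limits.PushoutCocone.IsColimit.mk _
    (fun c => (exists_lift c.inl.toFunctor c.inr.toFunctor
      (congrArg Cat.Hom.toFunctor c.condition)).choose.toCatHom)
    (fun c => congrArg Functor.toCatHom (exists_lift c.inl.toFunctor c.inr.toFunctor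
      (congrArg Cat.Hom.toFunctor c.condition)).choose_spec.1)
    (fun c => congrArg Functor.toCatHom (exists_lift c.inl.toFunctor c.inr.toFunctor
      (congrArg Cat.Hom.toFunctor c.condition)).choose_spec.2)
    (fun c _ h₁ h₂ => congrArg Functor.toCatHom (functor_ext
      ((congrArg Cat.Hom.toFunctor h₁).trans (exists_lift c.inl.toFunctor c.inr.toFunctor
        (congrArg Cat.Hom.toFunctor c.condition)).choose_spec.1.symm)
      ((congrArg Cat.Hom.toFunctor h₂).trans (exists_lift c.inl.toFunctor c.inr.toFunctor
        (congrArg Cat.Hom.toFunctor c.condition)).choose_spec.2.symm)))⟩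

end Collage

end Collage

/-! ### Comparison of gluing constructions -/

open Prederivator

section Comparison
variable {A₁ A₁' A₂ : Type u} [SmallCategory A₁] [SmallCategory A₁'] [SmallCategory A₂] {n : ℕ}

namespace Collage

/-- The two summands `A₁` and `A₂`, as a family of categories. -/
def coverSource (A₁ A₂ : Type u) [SmallCategory A₁] [SmallCategory A₂] : Bool → Cat.{u, u}
  | true => Cat.of A₁
  | false => Cat.of A₂

/-- The functors `u₁` and `𝟭 A₂`, as a family. -/
def coverFunctor (A₂ : Type u) [SmallCategory A₂] (u₁ : A₁ ⥤ A₁') :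
    ∀ i, coverSource A₁ A₂ i ⥤ coverSource A₁' A₂ i
  | true => u₁
  | false => 𝟭 A₂

/-- The inclusions of `A₁` and `A₂` in the collage, as a family. -/
def coverIncl (s : Fin n → A₁) (t : Fin n → A₂) : ∀ i, coverSource A₁ A₂ i ⥤ Collage s t
  | true => inclLeft s t
  | false => inclRight s t

/-- The functor between collages induced by `u₁` is covered by `u₁` and `𝟭 A₂`. -/
def exactCover (s : Fin n → A₁) (t : Fin n → A₂) (u₁ : A₁ ⥤ A₁') :
    ExactCover (map s t u₁) (coverFunctor A₂ u₁) (coverIncl s t)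
      (coverIncl (fun k => u₁.obj (s k)) t) where
  φ
    | true => inclLeftMapIso s t u₁
    | false => inclRightMapIso s t u₁
  exact
    | true => isLeftAdjoint_map₂_inclLeft u₁
    | false => isLeftAdjoint_map₂_inclRight u₁
  source
    | .left a => ⟨true, a, rfl⟩
    | .right a => ⟨false, a, rfl⟩
  target
    | .left a => ⟨true, a, rfl⟩
    | .right a => ⟨false, a, rfl⟩

end Collage

namespace FreeOrientedGluing

variable {s : Fin n → A₁} {t : Fin n → A₂}

/-- The identification of the explicit gluing construction with a given one. -/
noncomputable def isoCollage (G : FreeOrientedGluing s t) : Cat.of (Collage s t) ≅ Cat.of G.pt :=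
  (Collage.isPushout s t).isoIsPushout _ _ G.isPushout

/-- The isomorphism from the explicit gluing construction to a given one, as a functor. -/
noncomputable def ofCollage (G : FreeOrientedGluing s t) : Collage s t ⥤ G.pt :=
  G.isoCollage.hom.toFunctor

theorem incl_comp_ofCollage (G : FreeOrientedGluing s t) :
    Collage.incl s t ⋙ G.ofCollage = G.incl :=
  congrArg Cat.Hom.toFunctor ((Collage.isPushout s t).inl_isoIsPushout_hom _ _ G.isPushout)

theorem β_comp_ofCollage (G : FreeOrientedGluing s t) :
    Collage.generators s t ⋙ G.ofCollage = G.β :=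
  congrArg Cat.Hom.toFunctor ((Collage.isPushout s t).inr_isoIsPushout_hom _ _ G.isPushout)

instance (G : FreeOrientedGluing s t) : G.ofCollage.IsEquivalence :=
  (Cat.equivOfIso G.isoCollage).isEquivalence_functor

theorem ofCollage_obj_surjective (G : FreeOrientedGluing s t) (a : G.pt) :
    ∃ x, G.ofCollage.obj x = a :=
  ⟨G.isoCollage.inv.toFunctor.obj a,
    Functor.congr_obj (congrArg Cat.Hom.toFunctor G.isoCollage.inv_hom_id) a⟩

theorem map_comp_ofCollage (G : FreeOrientedGluing s t) (u₁ : A₁ ⥤ A₁')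
    (G' : FreeOrientedGluing (fun k => u₁.obj (s k)) t) :
    Collage.map s t u₁ ⋙ G'.ofCollage = G.ofCollage ⋙ G.induced G' u₁ (fun _ => rfl) := by
  have h₁ : G.incl ⋙ G.induced G' u₁ (fun _ => rfl) = u₁.sum (𝟭 A₂) ⋙ G'.incl :=
    congrArg Cat.Hom.toFunctor (G.isPushout.inl_desc _ _ _)
  have h₂ : G.β ⋙ G.induced G' u₁ (fun _ => rfl) = G'.β :=
    congrArg Cat.Hom.toFunctor (G.isPushout.inr_desc _ _ _)
  apply Collage.functor_ext
  · rw [← Functor.assoc, ← Functor.assoc, G.incl_comp_ofCollage, h₁, ← G'.incl_comp_ofCollage]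
    exact functor_sum_ext rfl rfl
  · rw [← Functor.assoc, ← Functor.assoc, G.β_comp_ofCollage, h₂, ← G'.β_comp_ofCollage]
    refine congrArg (· ⋙ G'.ofCollage)
      (functor_sigma_ext fun k => functor_unitArrow_ext rfl rfl ?_)
    change Collage.Hom.cross k (u₁.map (𝟙 (s k))) (𝟙 (t k)) =
      𝟙 _ ≫ Collage.gen (fun k => u₁.obj (s k)) t k ≫ 𝟙 _
    rw [Category.id_comp, Category.comp_id, u₁.map_id]
    rfl

/-- The functor induced by `u₁` between arbitrary gluing constructions is covered by the one between
the explicit ones. -/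
noncomputable def exactCover (G : FreeOrientedGluing s t) (u₁ : A₁ ⥤ A₁')
    (G' : FreeOrientedGluing (fun k => u₁.obj (s k)) t) :
    ExactCover (G.induced G' u₁ fun _ => rfl) (fun _ : Unit => Collage.map s t u₁)
      (fun _ => G.ofCollage) (fun _ => G'.ofCollage) where
  φ _ := eqToIso (G.map_comp_ofCollage u₁ G')
  exact _ _ := inferInstance
  source a := ⟨(), G.ofCollage_obj_surjective a⟩
  target a := ⟨(), G'.ofCollage_obj_surjective a⟩

end FreeOrientedGluing
end Comparison

theorem mainTheorem5
    {A₁ A₁' A₂ : Type u} [SmallCategory A₁] [SmallCategory A₁'] [SmallCategory A₂] {n : ℕ}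
    {s : Fin n → A₁} {s' : Fin n → A₁'} {t : Fin n → A₂}
    (G : FreeOrientedGluing s t) (G' : FreeOrientedGluing s' t)
    (u₁ : A₁ ⥤ A₁') (hs : ∀ k, s' k = u₁.obj (s k))
    (hu₁ : IsHomotopicalEpi.{u, v, w} u₁) :
    IsHomotopicalEpi.{u, v, w} (G.induced G' u₁ hs) ∧
      ∀ D : Prederivator.{u, v, w}, D.IsDerivator →
        (∀ X : D.Diag G.pt,
          (D.res (G.induced G' u₁ hs)).essImage X ↔
            (D.res u₁).essImage ((D.res G.i₁).obj X)) ∧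
        (∀ (C : Type u) [SmallCategory C] (X : (D.shift G.pt).Diag C),
          (D.shiftRes (G.induced G' u₁ hs) C).essImage X ↔
            (D.shiftRes u₁ C).essImage ((D.shiftRes G.i₁ C).obj X)) := by
  obtain rfl : s' = fun k => u₁.obj (s k) := funext hs
  -- Full faithfulness passes from `u₁` and `𝟭 A₂` to the collages, and from there to `G` and `G'`.
  have hfam (D : Prederivator.{u, v, w}) (hD : D.IsDerivator) (i : Bool) :
      (D.res (Collage.coverFunctor A₂ u₁ i)).Full ∧
        (D.res (Collage.coverFunctor A₂ u₁ i)).Faithful := by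
    cases i with
    | true => exact hu₁ D hD
    | false =>
      change (D.res (𝟭 A₂)).Full ∧ (D.res (𝟭 A₂)).Faithful
      rw [D.res_id]
      exact ⟨inferInstance, inferInstance⟩
  have hmap (D : Prederivator.{u, v, w}) (hD : D.IsDerivator) :
      (D.res (Collage.map s t u₁)).Full ∧ (D.res (Collage.map s t u₁)).Faithful :=
    (Collage.exactCover s t u₁).full_faithful hD (hfam D hD)
  have hff : IsHomotopicalEpi.{u, v, w} (G.induced G' u₁ hs) := fun D hD =>
    (G.exactCover u₁ G').full_faithful hD fun _ => hmap D hD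
  have hess (D : Prederivator.{u, v, w}) (hD : D.IsDerivator) (X : D.Diag G.pt) :
      (D.res (G.induced G' u₁ hs)).essImage X ↔ (D.res u₁).essImage ((D.res G.i₁).obj X) := by
    have hi : G.i₁ = Collage.inclLeft s t ⋙ G.ofCollage :=
      congrArg (Sum.inl_ A₁ A₂ ⋙ ·) G.incl_comp_ofCollage.symm
    rw [hi, D.res_obj_comp]
    have h₁ := (G.exactCover u₁ G').essImage_iff hD (fun _ => hmap D hD) X
    have h₂ := (Collage.exactCover s t u₁).essImage_iff hD (hfam D hD)
      ((D.res G.ofCollage).obj X)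
    rw [h₁]
    constructor
    · exact fun h => h₂.1 (h ()) true
    · rintro h ⟨⟩
      refine h₂.2 fun i => ?_
      cases i with
      | true => exact h
      | false =>
        -- On `A₂` the condition is empty.
        change (D.res (𝟭 A₂)).essImage _
        rw [D.res_id]
        exact ⟨_, ⟨Iso.refl _⟩⟩
  refine ⟨hff, fun D hD => ⟨hess D hD, fun C _ X => ?_⟩⟩
  -- Both conditions on `X ∈ D(A × C)` can be tested at the objects of `C`.
  refine (essImage_shiftRes_iff hD _ (hff D hD) C X).trans (Iff.trans ?_
    (essImage_shiftRes_iff hD _ (hu₁ D hD) C _).symm)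
  refine forall_congr' fun c => (hess D hD _).trans (iff_of_eq (congrArg _ ?_))
  exact (D.res_obj_comp G.i₁ (Prod.sectL G.pt c) X).symm.trans
    (D.res_obj_comp (Prod.sectL A₁ c) (G.i₁.prod (𝟭 C)) X)
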